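/- **Theorem 6.9.** Let $\mathbb{k}$ be a field of characteristic other than $2$. Lines are lines of the affine plane $\mathbb{k}^2$; each line $\ell$ has a unique equation $t_\ell X-u_\ell Y+v_\ell=0$ with $u_\ell=1$, or $u_\ell=0$ and $t_\ell=1$. Lines are parallel if they have the same direction (so a line is parallel to itself). A *pair of lines* is an unordered pair whose two members may coincide. *Bisection.* A line $\ell$ *crosses* a pair $\{m,n\}$ if $\ell\ne m$, $\ell\neq n$, and $\ell$ is not parallel to both $m$ and $n$. Its midpoint on $\{m,n\}$ is then the midpoint of $\ell\cap m$ and $\ell\cap n$, or the point at infinity of $\ell$ if $\ell$ is parallel to one of $m,n$. A line *bisects* a collection of pairs if it has the same midpoint on all pairs of the collection that it crosses. *Quadrilaterals.* A *quadrilateral* $Q=ABA'B'$ consists of four distinct lines that do not all pass through one point, such that the adjacent sides (that is, $A,B$; $B,A'$; $A',B'$; $B',A$) are not parallel; the pairs of opposite sides $\{A,A'\}$, $\{B,B'\}$ may be parallel, and three sides may be concurrent. The *centroid* of $Q$ is the midpoint of the midpoint of $A\cap B$ and $A'\cap B'$ and the midpoint of $B\cap A'$ and $B'\cap A$. A *bisector*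 of $Q$ is a line that bisects $\{\{A,A'\},\{B,B'\}\}$; it crosses at least one of these two pairs, and its midpoint there is finite and is called its midpoint. Put $$\begin{aligned}\alpha&=t_Au_Bu_{A'}u_{B'}-u_At_Bu_{A'}u_{B'}+u_Au_Bt_{A'}u_{B'}-u_Au_Bu_{A'}t_{B'},\\ \beta&=t_Au_Bt_{A'}u_{B'}-u_At_Bu_{A'}t_{B'},\\ \gamma&=t_At_Bt_{A'}u_{B'}-t_At_Bu_{A'}t_{B'}+t_Au_Bt_{A'}t_{B'}-u_At_Bt_{A'}t_{B'}.\end{aligned}$$ A *$Q$-pair of bisectors* is a pair $\{\ell,m\}$ of bisectors of $Q$ such that the midpoint of the midpoints of $\ell$ and $m$ is the centroid of $Q$, and $\gamma u_\ell u_m-\beta(u_\ell t_m+t_\ell u_m)+\alpha t_\ell t_m=0$. *Bisector fields.* A collection $\mathbb{B}$ of pairs of lines is a *bisector arrangement* if every line of every pair in $\mathbb{B}$ bisects $\mathbb{B}$. It is *trivial* if all its lines pass through a common point, or are all parallel, or if every pair in $\mathbb{B}$ is a translate of every other pair in $\mathbb{B}$. A *bisector field* is a nontrivial bisector arrangement that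 is not properly contained in another bisector arrangement. It is *affine* if, whenever a line of one pair in $\mathbb{B}$ is parallel to a line of a different pair in $\mathbb{B}$, all the lines of these two pairs are parallel. Then a collection $\mathbb{B}$ of pairs of lines is an affine bisector field if and only if there is a quadrilateral $Q$ such that $\mathbb{B}$ is the set of $Q$-pairs of bisectors of $Q$. In particular, every bisector $\ell$ of a quadrilateral $Q$ bisects the collection of $Q$-pairs of bisectors of $Q$; more precisely, on every $Q$-pair that $\ell$ crosses, its midpoint is the midpoint of $\ell$ as a bisector of $Q$. -/

import Mathlib

namespace BisectorField

/-- A line of the affine plane `𝕜 × 𝕜`, given by its equation `t X - u Y + v = 0` with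
canonically normalized coefficients: `u = 1`, or `u = 0` and `t = 1`. -/
@[ext]
structure Line (𝕜 : Type*) [Field 𝕜] where
  t : 𝕜
  u : 𝕜
  v : 𝕜
  normalized : u = 1 ∨ (u = 0 ∧ t = 1)

/-- The midpoint of two points of the plane. -/
def mid {𝕜 : Type*} [Field 𝕜] (p q : 𝕜 × 𝕜) : 𝕜 × 𝕜 :=
  ((p.1 + q.1) / 2, (p.2 + q.2) / 2)

namespace Line

/-- The points of a line. -/
def points {𝕜 : Type*} [Field 𝕜] (l : Line 𝕜) : Set (𝕜 × 𝕜) :=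
  {p | l.t * p.1 - l.u * p.2 + l.v = 0}

/-- Two lines are parallel if they have the same direction (the same point at infinity);
in particular a line is parallel to itself. -/
def Parallel {𝕜 : Type*} [Field 𝕜] (l m : Line 𝕜) : Prop :=
  l.t = m.t ∧ l.u = m.u

/-- The intersection point of two lines that are not parallel. -/
def meet {𝕜 : Type*} [Field 𝕜] (l m : Line 𝕜) : 𝕜 × 𝕜 :=
  ((l.v * m.u - l.u * m.v) / (l.u * m.t - l.t * m.u),
    (l.v * m.t - l.t * m.v) / (l.u * m.t - l.t * m.u))

/-- The line `l` moved by the vector `w`. -/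
def translate {𝕜 : Type*} [Field 𝕜] (w : 𝕜 × 𝕜) (l : Line 𝕜) : Line 𝕜 where
  t := l.t
  u := l.u
  v := l.v - l.t * w.1 + l.u * w.2
  normalized := l.normalized

/-- A line is determined by its points. -/
theorem points_injective {𝕜 : Type*} [Field 𝕜] :
    Function.Injective (points : Line 𝕜 → Set (𝕜 × 𝕜)) := by
  intro l m h
  have key : ∀ x y : 𝕜, l.t * x - l.u * y + l.v = 0 ↔ m.t * x - m.u * y + m.v = 0 := fun x y =>
    (Set.ext_iff.1 h (x, y))
  rcases l with ⟨t, u, v, hl⟩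
  rcases m with ⟨t', u', v', hm⟩
  simp only at key
  rcases hl with rfl | ⟨rfl, rfl⟩ <;> rcases hm with rfl | ⟨rfl, rfl⟩
  · have h0 := (key 0 v).1 (by ring)
    have h1 := (key 1 (t + v)).1 (by ring)
    have e : v' = v := by linear_combination h0
    subst e
    have e' : t' = t := by linear_combination h1
    subst e'
    rfl
  · have h0 := (key 0 v).1 (by ring)
    have h1 := (key 1 (t + v)).1 (by ring)
    exact absurd (show (1 : 𝕜) = 0 by linear_combination h1 - h0) one_ne_zero
  · have h0 := (key (-v) 0).1 (by ring)
    have h1 := (key (-v) 1).1 (by ring)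
    exact absurd (show (1 : 𝕜) = 0 by linear_combination h0 - h1) one_ne_zero
  · have h0 := (key (-v) 0).1 (by ring)
    have e : v' = v := by linear_combination h0
    subst e
    rfl

/-- Lines that are not parallel have exactly one common point, namely `meet`. -/
theorem mem_points_inter_iff {𝕜 : Type*} [Field 𝕜] {l m : Line 𝕜} (h : ¬ l.Parallel m)
    (p : 𝕜 × 𝕜) : p ∈ l.points ∧ p ∈ m.points ↔ p = l.meet m := by
  have hD : l.u * m.t - l.t * m.u ≠ 0 := by
    intro h0
    apply h
    rcases l.normalized with hu | ⟨hu, ht⟩ <;> rcases m.normalized with hu' | ⟨hu', ht'⟩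
    · refine ⟨?_, by rw [hu, hu']⟩
      rw [hu, hu'] at h0
      linear_combination -h0
    · rw [hu, hu', ht'] at h0
      simp at h0
    · rw [hu, hu', ht] at h0
      simp at h0
    · exact ⟨by rw [ht, ht'], by rw [hu, hu']⟩
  rcases p with ⟨x, y⟩
  simp only [points, meet, Set.mem_ofPred_eq, Prod.mk.injEq]
  constructor
  · rintro ⟨h1, h2⟩
    constructor
    · rw [eq_div_iff hD]
      linear_combination l.u * h2 - m.u * h1
    · rw [eq_div_iff hD]
      linear_combination l.t * h2 - m.t * h1
  · rintro ⟨rfl, rfl⟩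
    generalize hE : l.u * m.t - l.t * m.u = E at hD
    constructor
    · field_simp
      rw [← hE]
      ring
    · field_simp
      rw [← hE]
      ring

/-- The line `l` crosses the pair `P`: it is distinct from both lines of `P` and it is not parallel
to both of them. The pair is unordered, and its two lines may coincide. -/
def Crosses {𝕜 : Type*} [Field 𝕜] (l : Line 𝕜) (P : Sym2 (Line 𝕜)) : Prop :=
  l ∉ P ∧ ¬ ∀ m ∈ P, l.Parallel m

open Classical in
/-- For a line `l` that crosses the pair `P`, the midpoint of the two points where `l` meets the
lines of `P`; the value `none` stands for the point at infinity of `l`, which is the midpoint when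
`l` is parallel to a line of `P`. -/
noncomputable def midOn {𝕜 : Type*} [Field 𝕜] (l : Line 𝕜) (P : Sym2 (Line 𝕜)) :
    Option (𝕜 × 𝕜) :=
  Sym2.lift ⟨fun m n =>
    if l.Parallel m ∨ l.Parallel n then none else some (mid (l.meet m) (l.meet n)), by
      intro m n
      simp only [or_comm, mid, add_comm]⟩ P

/-- The line `l` bisects the collection `C` of pairs of lines: it has the same midpoint on all the
pairs of `C` that it crosses. -/
def Bisects {𝕜 : Type*} [Field 𝕜] (l : Line 𝕜) (C : Set (Sym2 (Line 𝕜))) : Prop :=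
  ∀ P ∈ C, ∀ P' ∈ C, l.Crosses P → l.Crosses P' → l.midOn P = l.midOn P'

end Line

/-- A (complete) quadrilateral `A B A' B'`, possibly improper: four distinct lines, not all through
one point, such that adjacent sides are not parallel (so adjacent sides are distinct). Opposite
sides are `A, A'` and `B, B'`. -/
structure Quadrilateral (𝕜 : Type*) [Field 𝕜] where
  A : Line 𝕜
  B : Line 𝕜
  A' : Line 𝕜
  B' : Line 𝕜
  A_ne_A' : A ≠ A'
  B_ne_B' : B ≠ B'
  not_parallel_AB : ¬ A.Parallel B
  not_parallel_BA' : ¬ B.Parallel A'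
  not_parallel_A'B' : ¬ A'.Parallel B'
  not_parallel_B'A : ¬ B'.Parallel A
  not_concurrent : ¬ ∃ p, p ∈ A.points ∧ p ∈ B.points ∧ p ∈ A'.points ∧ p ∈ B'.points

namespace Quadrilateral

/-- The two pairs of opposite sides. -/
def oppositeSides {𝕜 : Type*} [Field 𝕜] (Q : Quadrilateral 𝕜) : Set (Sym2 (Line 𝕜)) :=
  {s(Q.A, Q.A'), s(Q.B, Q.B')}

/-- The centroid: the midpoint of the midpoints of the diagonals. One diagonal joins the vertices
`A ∩ B` and `A' ∩ B'`, the other one joins `B ∩ A'` and `B' ∩ A`. -/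
def centroid {𝕜 : Type*} [Field 𝕜] (Q : Quadrilateral 𝕜) : 𝕜 × 𝕜 :=
  mid (mid (Q.A.meet Q.B) (Q.A'.meet Q.B')) (mid (Q.B.meet Q.A') (Q.B'.meet Q.A))

/-- The coefficient `α` of the inner product of `Q`. -/
def α {𝕜 : Type*} [Field 𝕜] (Q : Quadrilateral 𝕜) : 𝕜 :=
  Q.A.t * Q.B.u * Q.A'.u * Q.B'.u - Q.A.u * Q.B.t * Q.A'.u * Q.B'.u
    + Q.A.u * Q.B.u * Q.A'.t * Q.B'.u - Q.A.u * Q.B.u * Q.A'.u * Q.B'.t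

/-- The coefficient `β` of the inner product of `Q`. -/
def β {𝕜 : Type*} [Field 𝕜] (Q : Quadrilateral 𝕜) : 𝕜 :=
  Q.A.t * Q.B.u * Q.A'.t * Q.B'.u - Q.A.u * Q.B.t * Q.A'.u * Q.B'.t

/-- The coefficient `γ` of the inner product of `Q`. -/
def γ {𝕜 : Type*} [Field 𝕜] (Q : Quadrilateral 𝕜) : 𝕜 :=
  Q.A.t * Q.B.t * Q.A'.t * Q.B'.u - Q.A.t * Q.B.t * Q.A'.u * Q.B'.t
    + Q.A.t * Q.B.u * Q.A'.t * Q.B'.t - Q.A.u * Q.B.t * Q.A'.t * Q.B'.t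

/-- The inner product of `Q`, with Gram matrix `!![γ, -β; -β, α]`. -/
def inner {𝕜 : Type*} [Field 𝕜] (Q : Quadrilateral 𝕜) (x y : 𝕜 × 𝕜) : 𝕜 :=
  Q.γ * x.1 * y.1 - Q.β * (x.1 * y.2 + x.2 * y.1) + Q.α * x.2 * y.2

/-- Two lines are `Q`-orthogonal if their direction vectors are orthogonal. -/
def Orthogonal {𝕜 : Type*} [Field 𝕜] (Q : Quadrilateral 𝕜) (l m : Line 𝕜) : Prop :=
  Q.inner (l.u, l.t) (m.u, m.t) = 0

/-- The line `l` bisects `Q`. -/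
def Bisector {𝕜 : Type*} [Field 𝕜] (Q : Quadrilateral 𝕜) (l : Line 𝕜) : Prop :=
  l.Bisects Q.oppositeSides

/-- The finite point `p` is the midpoint of the line `l` on a pair of opposite sides of `Q` that it
crosses. If `l` bisects `Q`, this says that `p` is the midpoint of the bisector `l`. -/
def HasMidpoint {𝕜 : Type*} [Field 𝕜] (Q : Quadrilateral 𝕜) (l : Line 𝕜) (p : 𝕜 × 𝕜) : Prop :=
  ∃ P ∈ Q.oppositeSides, l.Crosses P ∧ l.midOn P = some p

/-- Two bisectors of `Q` are `Q`-antipodal if the midpoint of their midpoints is the centroid. -/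
def Antipodal {𝕜 : Type*} [Field 𝕜] (Q : Quadrilateral 𝕜) (l m : Line 𝕜) : Prop :=
  ∃ p q, Q.HasMidpoint l p ∧ Q.HasMidpoint m q ∧ mid p q = Q.centroid

/-- The set of `Q`-pairs of bisectors of `Q`: the unordered pairs of (possibly equal) bisectors that
are `Q`-antipodal and `Q`-orthogonal. -/
def qPairs {𝕜 : Type*} [Field 𝕜] (Q : Quadrilateral 𝕜) : Set (Sym2 (Line 𝕜)) :=
  {P | ∃ l m, P = s(l, m) ∧ Q.Bisector l ∧ Q.Bisector m ∧ Q.Antipodal l m ∧ Q.Orthogonal l m}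

end Quadrilateral

/-- A bisector arrangement: each line of each pair in `𝔹` bisects `𝔹`. -/
def IsBisectorArrangement {𝕜 : Type*} [Field 𝕜] (𝔹 : Set (Sym2 (Line 𝕜))) : Prop :=
  ∀ P ∈ 𝔹, ∀ l ∈ P, l.Bisects 𝔹

/-- Triviality: all lines of the arrangement pass through one point, or they all pass through one
point at infinity, or every pair is a translate of every other pair. -/
def IsTrivial {𝕜 : Type*} [Field 𝕜] (𝔹 : Set (Sym2 (Line 𝕜))) : Prop :=
  (∃ p, ∀ P ∈ 𝔹, ∀ l ∈ P, p ∈ l.points) ∨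
  (∀ P ∈ 𝔹, ∀ l ∈ P, ∀ P' ∈ 𝔹, ∀ l' ∈ P', l.Parallel l') ∨
  (∀ P ∈ 𝔹, ∀ P' ∈ 𝔹, ∃ w, P' = Sym2.map (Line.translate w) P)

/-- A bisector field: a nontrivial bisector arrangement that has no larger bisector arrangement
as an extension. -/
def IsBisectorField {𝕜 : Type*} [Field 𝕜] (𝔹 : Set (Sym2 (Line 𝕜))) : Prop :=
  IsBisectorArrangement 𝔹 ∧ ¬ IsTrivial 𝔹 ∧
    ∀ 𝔹', IsBisectorArrangement 𝔹' → 𝔹 ⊆ 𝔹' → 𝔹' = 𝔹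

/-- No cross-pair parallels: if a line of one pair is parallel (or equal) to a line of another pair,
then it is parallel to both lines of that pair, so that (by symmetry) all the lines of the two pairs
are parallel. Two such pairs of parallel lines have to be admitted, because they occur in the
bisector field of every quadrilateral that has a pair of parallel sides or diagonals. -/
def IsAffine {𝕜 : Type*} [Field 𝕜] (𝔹 : Set (Sym2 (Line 𝕜))) : Prop :=
  ∀ P ∈ 𝔹, ∀ P' ∈ 𝔹, P ≠ P' → ∀ l ∈ P, ∀ l' ∈ P', l.Parallel l' → ∀ m ∈ P', l.Parallel m

/-- An affine bisector field. -/
def IsAffineBisectorField {𝕜 : Type*} [Field 𝕜] (𝔹 : Set (Sym2 (Line 𝕜))) : Prop :=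
  IsBisectorField 𝔹 ∧ IsAffine 𝔹

end BisectorField

/-!
A pair of lines `{m, n}` is encoded by the product of the linear forms of `m` and `n`, a quadratic
polynomial in two variables which is taken modulo constants (`quad`). On the line `l`, parametrized
by `s`, such a polynomial `f` restricts to `lead l f * s² + lin l f * s` modulo constants. The line
crosses the pair exactly if this restriction is not zero, and its midpoint there is the point with
parameter `-lin / (2 * lead)`, the infinite one if `lead = 0`. Hence `l` bisects a collection exactly
if the restrictions of all its products are proportional (`bisects_iff`), which is a condition on
the linear span of the products. In particular the set of all pairs whose products lie in the span
of two given ones, the `net` of two pairs, is a bisector arrangement: if `l` belongs to a pair of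
the net, then some nontrivial combination of the two given products vanishes on `l`.

The set of `Q`-pairs of a quadrilateral `Q` is the net of its pairs of opposite sides
(`Quadrilateral.qPairs_eq_sideNet`). Dividing by a linear form shows that each bisector `l` belongs
to a pair `{l, n}` of the net. The inner product of `Q` is the linear functional whose kernel is the
span of the quadratic parts of the two products, so the lines of a pair of the net are orthogonal.
They are antipodal because a net of conics has a centroid (`netCentroid`) which can be computed from
any two of its generators `f` and `g`, and which is the midpoint of the midpoints of `l` and `n` on `g`
if `f` is the product of `l` and `n`; applied to the sides of `Q` this is the centroid of `Q`. As the
inner product is nondegenerate, `n` is the only line which forms a `Q`-pair with `l`.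

An arrangement which contains the pairs of opposite sides of `Q` lies in the net of `Q`
(`Quadrilateral.subset_sideNet`). This makes the net maximal, and it reduces the converse to finding
a quadrilateral among the pairs of an affine bisector field. If there were none, the field would
consist of pairs in the net of two distinct lines `{l, m}` and one double line `{n, n}`
(`IsAffineBisectorField.containsQuadrilateral`). By maximality it would then be this net, which
contains a pair of distinct parallels of `n`, and these form a quadrilateral with `l` and `m`.
-/

namespace BisectorField

variable {𝕜 : Type*} [Field 𝕜]

/-! ### Parametrized lines -/

namespace Line

/-- The determinant of the directions of two lines, which is also the slope of the linear form of
`m` along the parametrized line `l`. -/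
def wedge (m l : Line 𝕜) : 𝕜 := m.t * l.u - m.u * l.t

/-- A base point on the line: the intercept with the `Y`-axis, or with the `X`-axis for vertical
lines. Since `u` is `0` or `1`, one formula covers both cases. -/
def base (l : Line 𝕜) : 𝕜 × 𝕜 := ((l.u - 1) * l.v, l.u * l.v)

/-- The affine parametrization of a line by its base point and the direction vector `(u, t)`. -/
def param (l : Line 𝕜) (s : 𝕜) : 𝕜 × 𝕜 := (l.base.1 + s * l.u, l.base.2 + s * l.t)

/-- The value of the linear form of `m` at the base point of `l`. -/
def offset (m l : Line 𝕜) : 𝕜 := m.t * l.base.1 - m.u * l.base.2 + m.v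

theorem wedge_swap (m l : Line 𝕜) : m.wedge l = -l.wedge m := by
  simp only [wedge]; ring

theorem parallel_iff_wedge {l m : Line 𝕜} : l.Parallel m ↔ m.wedge l = 0 := by
  rcases l with ⟨t, u, v, rfl | ⟨rfl, rfl⟩⟩ <;> rcases m with ⟨t', u', v', rfl | ⟨rfl, rfl⟩⟩ <;>
    simp [Parallel, wedge, sub_eq_zero, eq_comm]

theorem wedge_ne_zero {l m : Line 𝕜} (h : ¬ l.Parallel m) : m.wedge l ≠ 0 :=
  fun h0 => h (parallel_iff_wedge.2 h0)

theorem Parallel.symm {l m : Line 𝕜} (h : l.Parallel m) : m.Parallel l := ⟨h.1.symm, h.2.symm⟩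

theorem Parallel.trans {l m n : Line 𝕜} (h : l.Parallel m) (h' : m.Parallel n) : l.Parallel n :=
  ⟨h.1.trans h'.1, h.2.trans h'.2⟩

theorem Parallel.refl (l : Line 𝕜) : l.Parallel l := ⟨rfl, rfl⟩

@[simp] theorem wedge_self (l : Line 𝕜) : l.wedge l = 0 := by simp only [wedge]; ring

@[simp] theorem offset_self (l : Line 𝕜) : l.offset l = 0 := by
  rcases l with ⟨t, u, v, rfl | ⟨rfl, rfl⟩⟩ <;> simp [offset, base]

theorem eq_of_parallel_of_offset {l m : Line 𝕜} (h : l.Parallel m) (h0 : m.offset l = 0) :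
    l = m := by
  obtain ⟨ht, hu⟩ := h
  have := l.offset_self
  simp only [offset] at h0 this
  rw [← ht, ← hu] at h0
  ext
  · exact ht
  · exact hu
  · linear_combination this - h0

theorem param_mem_iff (l m : Line 𝕜) (s : 𝕜) :
    l.param s ∈ m.points ↔ m.wedge l * s + m.offset l = 0 := by
  simp only [points, param, Set.mem_ofPred_eq, wedge, offset]
  constructor <;> intro h <;> linear_combination h

theorem param_mem (l : Line 𝕜) (s : 𝕜) : l.param s ∈ l.points := by
  simp [param_mem_iff]

theorem param_injective (l : Line 𝕜) : Function.Injective l.param := by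
  intro s s' h
  rcases l with ⟨t, u, v, rfl | ⟨rfl, rfl⟩⟩ <;> simp_all [param, base]

theorem meet_eq_param {l m : Line 𝕜} (h : ¬ l.Parallel m) :
    l.meet m = l.param (-(m.offset l) / m.wedge l) := by
  refine ((mem_points_inter_iff h _).1 ⟨param_mem _ _, ?_⟩).symm
  rw [param_mem_iff]
  field_simp [wedge_ne_zero h]
  ring

theorem meet_mem_left {l m : Line 𝕜} (h : ¬ l.Parallel m) : l.meet m ∈ l.points :=
  ((mem_points_inter_iff h _).2 rfl).1

theorem meet_mem_right {l m : Line 𝕜} (h : ¬ l.Parallel m) : l.meet m ∈ m.points :=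
  ((mem_points_inter_iff h _).2 rfl).2

theorem meet_comm (l m : Line 𝕜) : l.meet m = m.meet l := by
  have e : l.u * m.t - l.t * m.u = -(m.u * l.t - m.t * l.u) := by ring
  simp only [meet]
  rw [e, div_neg, div_neg, ← neg_div, ← neg_div]
  congr 2 <;> ring

theorem eq_of_parallel_of_mem {l m : Line 𝕜} (h : l.Parallel m) {p : 𝕜 × 𝕜} (hl : p ∈ l.points)
    (hm : p ∈ m.points) : l = m := by
  simp only [points, Set.mem_ofPred_eq] at hl hm
  obtain ⟨ht, hu⟩ := h
  ext
  · exact ht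
  · exact hu
  · rw [← ht, ← hu] at hm
    linear_combination hl - hm

/-- Two different points lie on at most one line. -/
theorem eq_of_two_points {l m : Line 𝕜} {p q : 𝕜 × 𝕜} (hpq : p ≠ q) (hp : p ∈ l.points)
    (hq : q ∈ l.points) (hp' : p ∈ m.points) (hq' : q ∈ m.points) : l = m := by
  by_cases h : l.Parallel m
  · exact eq_of_parallel_of_mem h hp hp'
  · exact absurd (((mem_points_inter_iff h p).1 ⟨hp, hp'⟩).trans
      ((mem_points_inter_iff h q).1 ⟨hq, hq'⟩).symm) hpq

/-- Every nonconstant linear form is a multiple of the linear form of a line. -/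
theorem exists_smul (t u v : 𝕜) (h : t ≠ 0 ∨ u ≠ 0) :
    ∃ (m : Line 𝕜) (c : 𝕜), c ≠ 0 ∧ t = c * m.t ∧ u = c * m.u ∧ v = c * m.v := by
  by_cases hu : u = 0
  · have ht : t ≠ 0 := by tauto
    exact ⟨⟨1, 0, v / t, Or.inr ⟨rfl, rfl⟩⟩, t, ht, by simp, by simp [hu], by field_simp⟩
  · exact ⟨⟨t / u, 1, v / u, Or.inl rfl⟩, u, hu, by field_simp, by simp, by field_simp⟩

end Line

open Line

/-! ### Products of pairs of lines -/

/-- The product of the linear forms of the two lines of a pair, as a quadratic polynomial modulo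
constants: the coefficients of `X²`, `XY`, `Y²`, `X`, `Y`. -/
def quad (P : Sym2 (Line 𝕜)) : Fin 5 → 𝕜 :=
  Sym2.lift ⟨fun m n => ![m.t * n.t, -(m.t * n.u + m.u * n.t), m.u * n.u, m.t * n.v + m.v * n.t,
    -(m.u * n.v + m.v * n.u)], by
      intro m n
      ext i
      fin_cases i <;> simp <;> ring⟩ P

theorem quad_mk (m n : Line 𝕜) : quad s(m, n) =
    ![m.t * n.t, -(m.t * n.u + m.u * n.t), m.u * n.u, m.t * n.v + m.v * n.t,
      -(m.u * n.v + m.v * n.u)] := rfl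

theorem vec5_ext {R : Type*} {f g : Fin 5 → R} (h0 : f 0 = g 0) (h1 : f 1 = g 1) (h2 : f 2 = g 2)
    (h3 : f 3 = g 3) (h4 : f 4 = g 4) : f = g := by
  ext i
  fin_cases i <;> assumption

/-- The coefficient of `s²` in the restriction of the quadratic polynomial `f` to the
parametrized line `l`. -/
def lead (l : Line 𝕜) : (Fin 5 → 𝕜) →ₗ[𝕜] 𝕜 where
  toFun f := f 0 * l.u ^ 2 + f 1 * (l.u * l.t) + f 2 * l.t ^ 2
  map_add' f g := by simp only [Pi.add_apply]; ring
  map_smul' c f := by simp only [Pi.smul_apply, smul_eq_mul, RingHom.id_apply]; ring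

/-- The coefficient of `s` in the restriction of the quadratic polynomial `f` to the
parametrized line `l`. -/
def lin (l : Line 𝕜) : (Fin 5 → 𝕜) →ₗ[𝕜] 𝕜 where
  toFun f := 2 * f 0 * l.base.1 * l.u + f 1 * (l.base.1 * l.t + l.base.2 * l.u)
    + 2 * f 2 * l.base.2 * l.t + f 3 * l.u + f 4 * l.t
  map_add' f g := by simp only [Pi.add_apply]; ring
  map_smul' c f := by simp only [Pi.smul_apply, smul_eq_mul, RingHom.id_apply]; ring

theorem lead_apply (l : Line 𝕜) (f : Fin 5 → 𝕜) :
    lead l f = f 0 * l.u ^ 2 + f 1 * (l.u * l.t) + f 2 * l.t ^ 2 := rfl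

theorem lin_apply (l : Line 𝕜) (f : Fin 5 → 𝕜) :
    lin l f = 2 * f 0 * l.base.1 * l.u + f 1 * (l.base.1 * l.t + l.base.2 * l.u)
    + 2 * f 2 * l.base.2 * l.t + f 3 * l.u + f 4 * l.t := rfl

theorem lead_quad (l m n : Line 𝕜) : lead l (quad s(m, n)) = m.wedge l * n.wedge l := by
  simp [lead_apply, quad_mk, wedge]
  ring

theorem lin_quad (l m n : Line 𝕜) :
    lin l (quad s(m, n)) = m.wedge l * n.offset l + n.wedge l * m.offset l := by
  simp [lin_apply, quad_mk, wedge, offset]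
  ring

theorem lead_quad_of_mem {l : Line 𝕜} {P : Sym2 (Line 𝕜)} (h : l ∈ P) : lead l (quad P) = 0 := by
  obtain ⟨m, rfl⟩ := h
  simp [lead_quad]

theorem lin_quad_of_mem {l : Line 𝕜} {P : Sym2 (Line 𝕜)} (h : l ∈ P) : lin l (quad P) = 0 := by
  obtain ⟨m, rfl⟩ := h
  simp [lin_quad]

/-- A line crosses a pair exactly when the product of the pair is not constant on the line. -/
theorem crosses_iff (l : Line 𝕜) (P : Sym2 (Line 𝕜)) :
    l.Crosses P ↔ lead l (quad P) ≠ 0 ∨ lin l (quad P) ≠ 0 := by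
  induction P using Sym2.ind with
  | _ m n =>
    rw [← not_and_or, Crosses, ← not_or, not_iff_not]
    constructor
    · rintro (h | h)
      · exact ⟨lead_quad_of_mem h, lin_quad_of_mem h⟩
      · have hm := parallel_iff_wedge.1 (h m (by simp))
        have hn := parallel_iff_wedge.1 (h n (by simp))
        simp [lead_quad, lin_quad, hm, hn]
    · rw [lead_quad, lin_quad]
      rintro ⟨h1, h2⟩
      by_cases hm : m.wedge l = 0 <;> by_cases hn : n.wedge l = 0
      · right
        simp [parallel_iff_wedge, hm, hn]
      · left
        have : m.offset l = 0 := by simpa [hm, hn] using h2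
        simp [eq_of_parallel_of_offset (parallel_iff_wedge.2 hm) this]
      · left
        have : n.offset l = 0 := by simpa [hm, hn] using h2
        simp [eq_of_parallel_of_offset (parallel_iff_wedge.2 hn) this]
      · exact absurd h1 (mul_ne_zero hm hn)

open Classical in
/-- The midpoint of the zeros of `lead * s² + lin * s + const` is at `s = -lin / (2 * lead)`. -/
theorem midOn_eq (h2 : (2 : 𝕜) ≠ 0) (l : Line 𝕜) (P : Sym2 (Line 𝕜)) :
    l.midOn P = if lead l (quad P) = 0 then none else
      some (l.param (-(lin l (quad P)) / (2 * lead l (quad P)))) := by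
  induction P using Sym2.ind with
  | _ m n =>
    simp only [midOn, Sym2.lift_mk]
    by_cases hm : l.Parallel m
    · rw [if_pos (Or.inl hm), if_pos]
      rw [lead_quad, parallel_iff_wedge.1 hm, zero_mul]
    by_cases hn : l.Parallel n
    · rw [if_pos (Or.inr hn), if_pos]
      rw [lead_quad, parallel_iff_wedge.1 hn, mul_zero]
    have hm' := wedge_ne_zero hm
    have hn' := wedge_ne_zero hn
    rw [if_neg (by tauto), if_neg (by rw [lead_quad]; exact mul_ne_zero hm' hn'),
      meet_eq_param hm, meet_eq_param hn, lead_quad, lin_quad]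
    congr 1
    simp only [mid, param, Prod.mk.injEq]
    constructor <;> field_simp <;> ring

theorem midOn_eq_some (h2 : (2 : 𝕜) ≠ 0) {l : Line 𝕜} {P : Sym2 (Line 𝕜)}
    (h : lead l (quad P) ≠ 0) :
    l.midOn P = some (l.param (-(lin l (quad P)) / (2 * lead l (quad P)))) := by
  rw [midOn_eq h2, if_neg h]

/-- A line bisects a collection exactly when the products of the pairs of the collection, restricted
to the line and taken modulo constants, are proportional. -/
theorem bisects_iff (h2 : (2 : 𝕜) ≠ 0) (l : Line 𝕜) (C : Set (Sym2 (Line 𝕜))) :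
    l.Bisects C ↔ ∀ P ∈ C, ∀ P' ∈ C,
      lead l (quad P) * lin l (quad P') = lead l (quad P') * lin l (quad P) := by
  refine forall₂_congr fun P _ => forall₂_congr fun P' _ => ?_
  rw [crosses_iff, crosses_iff, midOn_eq h2, midOn_eq h2]
  generalize lead l (quad P) = a
  generalize lead l (quad P') = a'
  generalize lin l (quad P) = b
  generalize lin l (quad P') = b'
  by_cases ha : a = 0 <;> by_cases ha' : a' = 0
  · simp [ha, ha']
  · simp [ha, ha']
  · simp [ha, ha', eq_comm]
  · simp only [ne_eq, ha, not_false_eq_true, true_or, ha', if_false, forall_const,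
      Option.some.injEq, l.param_injective.eq_iff]
    field_simp
    constructor <;> intro h
    · linear_combination h
    · linear_combination h

/-- If the product of some pair of the collection has a finite midpoint on a line which bisects the
collection, then that point is the midpoint on all crossed pairs. -/
theorem midOn_eq_of_proportional (h2 : (2 : 𝕜) ≠ 0) {l : Line 𝕜} {P P' : Sym2 (Line 𝕜)}
    (hP : lead l (quad P) ≠ 0) (hP' : l.Crosses P')
    (h : lead l (quad P) * lin l (quad P') = lead l (quad P') * lin l (quad P)) :
    l.midOn P' = l.midOn P := by
  rw [crosses_iff] at hP'
  have ha' : lead l (quad P') ≠ 0 := by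
    intro h0
    rw [h0, zero_mul] at h
    rcases mul_eq_zero.1 h with h | h
    · exact hP h
    · tauto
  rw [midOn_eq_some h2 hP, midOn_eq_some h2 ha']
  congr 2
  field_simp
  linear_combination -h

/-- The quadratic part of the product of a pair does not vanish. -/
theorem quad_coeff_ne_zero (P : Sym2 (Line 𝕜)) :
    ¬ (quad P 0 = 0 ∧ quad P 1 = 0 ∧ quad P 2 = 0) := by
  induction P using Sym2.ind with
  | _ m n =>
    rcases m with ⟨t, u, v, rfl | ⟨rfl, rfl⟩⟩ <;> rcases n with ⟨t', u', v', rfl | ⟨rfl, rfl⟩⟩ <;>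
      simp [quad_mk]

theorem quad_ne_zero (P : Sym2 (Line 𝕜)) : quad P ≠ 0 := by
  intro h
  exact quad_coeff_ne_zero P (by simp [h])

/-- Division by a linear form: a quadratic polynomial which is constant on the line `l` is, up to a
constant, a product of the form of `l` and another linear form. -/
theorem exists_partner {l : Line 𝕜} {f : Fin 5 → 𝕜} (h1 : lead l f = 0) (h2 : lin l f = 0)
    (hf : ¬ (f 0 = 0 ∧ f 1 = 0 ∧ f 2 = 0)) : ∃ (m : Line 𝕜) (c : 𝕜), c ≠ 0 ∧ f = c • quad s(l, m) := by
  rw [lead_apply] at h1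
  rw [lin_apply] at h2
  rcases l with ⟨t, u, v, rfl | ⟨rfl, rfl⟩⟩
  · simp only [base, sub_self, zero_mul, one_mul] at h1 h2
    obtain ⟨m, c, hc, ht, hu, hv⟩ := exists_smul (-(f 1) - t * f 2) (f 2) (-(f 4) - v * f 2) (by
      by_contra! h
      obtain ⟨h, h'⟩ := h
      have e1 : f 1 = 0 := by linear_combination -h - t * h'
      exact hf ⟨by linear_combination h1 - t * e1 - t ^ 2 * h', e1, h'⟩)
    refine ⟨m, c, hc, vec5_ext ?_ ?_ ?_ ?_ ?_⟩ <;> simp [quad_mk]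
    · linear_combination h1 + t * ht
    · linear_combination -ht - t * hu
    · linear_combination hu
    · linear_combination h2 + t * hv + v * ht
    · linear_combination -hv - v * hu
  · simp only [base, zero_mul] at h1 h2
    obtain ⟨m, c, hc, ht, hu, hv⟩ := exists_smul (f 0) (-(f 1)) (f 3 - v * f 0) (by
      by_contra! h
      obtain ⟨h, h'⟩ := h
      exact hf ⟨h, by linear_combination -h', by linear_combination h1⟩)
    refine ⟨m, c, hc, vec5_ext ?_ ?_ ?_ ?_ ?_⟩ <;> simp [quad_mk]
    · linear_combination ht
    · linear_combination -hu
    · linear_combination h1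
    · linear_combination hv + v * ht
    · linear_combination h2 - v * hu

/-- A quadratic polynomial which is constant on each of two nonparallel lines is, up to a constant,
a multiple of the product of the forms of the two lines. -/
theorem eq_smul_quad_of_const {l m : Line 𝕜} (hlm : ¬ l.Parallel m) {f : Fin 5 → 𝕜}
    (h1 : lead l f = 0) (h2 : lin l f = 0) (h3 : lead m f = 0) (h4 : lin m f = 0) :
    ∃ c : 𝕜, f = c • quad s(l, m) := by
  have hs := wedge_ne_zero hlm
  by_cases hf : f 0 = 0 ∧ f 1 = 0 ∧ f 2 = 0
  · obtain ⟨h00, h01, h02⟩ := hf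
    simp only [lin_apply, h00, h01, h02] at h2 h4
    have e3 : f 3 = 0 := by
      refine (mul_eq_zero.1 (?_ : m.wedge l * f 3 = 0)).resolve_left hs
      simp only [wedge]
      linear_combination m.t * h2 - l.t * h4
    have e4 : f 4 = 0 := by
      refine (mul_eq_zero.1 (?_ : m.wedge l * f 4 = 0)).resolve_left hs
      simp only [wedge]
      linear_combination l.u * h4 - m.u * h2
    exact ⟨0, vec5_ext (by simpa) (by simpa) (by simpa) (by simpa) (by simpa)⟩
  · obtain ⟨n, c, hc, rfl⟩ := exists_partner h1 h2 hf
    have hs' : l.wedge m ≠ 0 := by rw [wedge_swap]; exact neg_ne_zero.2 hs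
    rw [map_smul, lead_quad, smul_eq_mul] at h3
    have hn : n.wedge m = 0 := by simpa [hc, hs'] using h3
    rw [map_smul, lin_quad, smul_eq_mul] at h4
    have hn' : n.offset m = 0 := by simpa [hc, hs', hn] using h4
    rw [eq_of_parallel_of_offset (parallel_iff_wedge.2 hn) hn']
    exact ⟨c, rfl⟩

/-! ### Nets of conics -/

/-- The net spanned by two pairs of lines: all pairs of lines whose product is a linear combination
of the products of the two given pairs and the constant `1`. -/
def net (P P' : Sym2 (Line 𝕜)) : Set (Sym2 (Line 𝕜)) :=
  {R | ∃ a b : 𝕜, quad R = a • quad P + b • quad P'}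

theorem left_mem_net (P P' : Sym2 (Line 𝕜)) : P ∈ net P P' := ⟨1, 0, by simp⟩

theorem right_mem_net (P P' : Sym2 (Line 𝕜)) : P' ∈ net P P' := ⟨0, 1, by simp⟩

/-- A line on which two products are proportional modulo constants bisects the net. -/
theorem bisects_net (h2 : (2 : 𝕜) ≠ 0) {l : Line 𝕜} {P P' : Sym2 (Line 𝕜)}
    (h : lead l (quad P) * lin l (quad P') = lead l (quad P') * lin l (quad P)) :
    l.Bisects (net P P') := by
  rw [bisects_iff h2]
  rintro R ⟨a, b, hR⟩ R' ⟨a', b', hR'⟩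
  rw [hR, hR']
  simp only [map_add, map_smul, smul_eq_mul]
  linear_combination (a * b' - b * a') * h

/-- On a line of a pair of the net, a nontrivial combination of the two generators vanishes modulo
constants, so their restrictions are proportional. -/
theorem isBisectorArrangement_net (h2 : (2 : 𝕜) ≠ 0) (P P' : Sym2 (Line 𝕜)) :
    IsBisectorArrangement (net P P') := by
  rintro R ⟨a, b, hR⟩ l hl
  apply bisects_net h2
  have e1 := lead_quad_of_mem hl
  have e2 := lin_quad_of_mem hl
  rw [hR] at e1 e2
  simp only [map_add, map_smul, smul_eq_mul] at e1 e2
  by_cases ha : a = 0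
  · by_cases hb : b = 0
    · exact absurd (by simp [hR, ha, hb]) (quad_ne_zero R)
    · apply mul_left_cancel₀ hb
      linear_combination lead l (quad P) * e2 - lin l (quad P) * e1
  · apply mul_left_cancel₀ ha
    linear_combination lin l (quad P') * e1 - lead l (quad P') * e2

/-- Suppose the restrictions to `l` of the products of the pairs `{n, m}` and `{n, r}` are
proportional modulo constants. Then `m` and `r` meet `l` in the same point. -/
theorem meet_mem_of_proportional {l m n r : Line 𝕜} (hn : ¬ l.Parallel n) (hr : ¬ l.Parallel r)
    (h : lead l (quad s(m, n)) * lin l (quad s(n, r)) =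
      lead l (quad s(n, r)) * lin l (quad s(m, n))) : l.meet r ∈ m.points := by
  have hn' := wedge_ne_zero hn
  have hr' := wedge_ne_zero hr
  rw [meet_eq_param hr, param_mem_iff]
  simp only [lead_quad, lin_quad] at h
  have : m.wedge l * r.offset l = r.wedge l * m.offset l := by
    apply mul_left_cancel₀ (pow_ne_zero 2 hn')
    linear_combination h
  field_simp
  linear_combination -this

/-- If the products of two pairs are proportional modulo constants and the pairs have a direction in
common, then the pairs are equal or all their lines are parallel. -/
theorem parallel_of_quad_eq_smul {R R' : Sym2 (Line 𝕜)} (hne : R ≠ R') {c : 𝕜} (hc : c ≠ 0)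
    (h : quad R' = c • quad R) {l l' : Line 𝕜} (hl : l ∈ R) (hl' : l' ∈ R') (hp : l.Parallel l') :
    ∀ m ∈ R', l.Parallel m := by
  have hcross : ∀ n : Line 𝕜, n.Crosses R ↔ n.Crosses R' := by
    intro n
    rw [crosses_iff, crosses_iff, h]
    simp [hc]
  have hmem : ∀ (n : Line 𝕜) (S : Sym2 (Line 𝕜)), n ∈ S → ¬ n.Crosses S := fun n S hn hS => hS.1 hn
  obtain ⟨n, rfl⟩ := hl
  obtain ⟨m, rfl⟩ := hl'
  by_cases hm : l.Parallel m
  · intro r hr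
    rcases Sym2.mem_iff.1 hr with rfl | rfl
    · exact hp
    · exact hm
  exfalso
  have hll : l = l' := by
    have h1 := mt (hcross l).2 (hmem l s(l, n) (by simp))
    by_contra hne'
    refine h1 ⟨fun hmem => ?_, fun hall => hm (hall m (by simp))⟩
    rcases Sym2.mem_iff.1 hmem with e | e
    · exact hne' e
    · exact hm (e ▸ Parallel.refl l)
  subst hll
  have h1 := mt (hcross m).1 (hmem m s(l, m) (by simp))
  refine h1 ⟨fun hmem => ?_, fun hall => hm (hall l (by simp)).symm⟩
  rcases Sym2.mem_iff.1 hmem with e | e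
  · exact hm (e ▸ Parallel.refl l)
  · exact hne (by rw [e])

/-! ### The centroid of a net -/

/-- The polar form of the discriminant of the quadratic part. -/
def polarDisc (f g : Fin 5 → 𝕜) : 𝕜 := 2 * f 0 * g 2 + 2 * f 2 * g 0 - f 1 * g 1

/-- The adjugate of the Hessian of `f` applied to the linear part of `g`. -/
def adjHess (f g : Fin 5 → 𝕜) : 𝕜 × 𝕜 := (2 * f 2 * g 3 - f 1 * g 4, 2 * f 0 * g 4 - f 1 * g 3)

/-- The centroid of the net of conics spanned by `f`, `g` and the constants. It depends only on the
net, and is the point `w` for which the two quadratic parts `q₁, q₂`, the linear parts `L₁, L₂` at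
the point `w` and the inverse of the Gram matrix of `polarDisc` satisfy
`∑ Gⁱʲ adj(qᵢ) Lⱼ = 0`. -/
def netCentroid (f g : Fin 5 → 𝕜) : 𝕜 × 𝕜 :=
  (-(1 / 2) * ((polarDisc g g * (adjHess f f).1 - polarDisc f g * ((adjHess f g).1 + (adjHess g f).1)
      + polarDisc f f * (adjHess g g).1) / (polarDisc f f * polarDisc g g - polarDisc f g ^ 2)),
    -(1 / 2) * ((polarDisc g g * (adjHess f f).2 - polarDisc f g * ((adjHess f g).2 + (adjHess g f).2)
      + polarDisc f f * (adjHess g g).2) / (polarDisc f f * polarDisc g g - polarDisc f g ^ 2)))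

theorem netCentroid_comm (f g : Fin 5 → 𝕜) : netCentroid f g = netCentroid g f := by
  have e : polarDisc f g = polarDisc g f := by simp only [polarDisc]; ring
  simp only [netCentroid, e, Prod.mk.injEq]
  constructor <;> congr 2 <;> ring

/-- Together with `netCentroid_comm`, this makes the centroid independent of the choice of two
generators of the net. -/
theorem netCentroid_smul_add {a : 𝕜} (ha : a ≠ 0) (b : 𝕜) (f g : Fin 5 → 𝕜) :
    netCentroid (a • f + b • g) g = netCentroid f g := by
  have ha2 : a ^ 2 ≠ 0 := pow_ne_zero 2 ha
  have e : polarDisc (a • f + b • g) (a • f + b • g) * polarDisc g g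
      - polarDisc (a • f + b • g) g ^ 2
      = a ^ 2 * (polarDisc f f * polarDisc g g - polarDisc f g ^ 2) := by
    simp only [polarDisc, Pi.add_apply, Pi.smul_apply, smul_eq_mul]; ring
  simp only [netCentroid, e, Prod.mk.injEq]
  constructor <;> congr 1 <;> rw [← mul_div_mul_left _ (polarDisc f f * _ - _) ha2] <;> congr 1 <;>
    simp only [polarDisc, adjHess, Pi.add_apply, Pi.smul_apply, smul_eq_mul] <;> ring

/-- The centroid of a net which contains the pair `{l, m}` is the midpoint of the midpoints of `l`
and `m` on any other conic `h` of the net. -/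
theorem netCentroid_quad (h2 : (2 : 𝕜) ≠ 0) (l m : Line 𝕜) (h : Fin 5 → 𝕜) (hl : lead l h ≠ 0)
    (hm : lead m h ≠ 0) :
    netCentroid (quad s(l, m)) h = mid (l.param (-(lin l h) / (2 * lead l h)))
      (m.param (-(lin m h) / (2 * lead m h))) := by
  -- The Gram determinant is, up to a factor, the resultant of the two quadratic parts.
  have e : polarDisc (quad s(l, m)) (quad s(l, m)) * polarDisc h h
      - polarDisc (quad s(l, m)) h ^ 2 = -4 * (lead l h * lead m h) := by
    simp [polarDisc, quad_mk, lead_apply]; ring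
  have h4 : (4 : 𝕜) ≠ 0 := by
    rw [show (4 : 𝕜) = 2 * 2 by norm_num]; exact mul_ne_zero h2 h2
  simp only [netCentroid, e, mid, param, Prod.mk.injEq]
  generalize ha : lead l h = a at *
  generalize hb : lead m h = b at *
  rw [lead_apply] at ha hb
  rcases l with ⟨t, u, v, rfl | ⟨rfl, rfl⟩⟩ <;> rcases m with ⟨t', u', v', rfl | ⟨rfl, rfl⟩⟩ <;>
    simp only [polarDisc, adjHess, quad_mk, base, lin_apply] <;>
    constructor <;> field_simp <;> simp <;> rw [← ha, ← hb] <;> ring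

/-! ### Bisectors of a quadrilateral -/

namespace Quadrilateral

variable (Q : Quadrilateral 𝕜)

/-- The net spanned by the two pairs of opposite sides. -/
def sideNet : Set (Sym2 (Line 𝕜)) := net s(Q.A, Q.A') s(Q.B, Q.B')

theorem lead_AA'_B : lead Q.B (quad s(Q.A, Q.A')) ≠ 0 := by
  rw [lead_quad]
  exact mul_ne_zero (wedge_ne_zero fun h => Q.not_parallel_AB h.symm)
    (wedge_ne_zero Q.not_parallel_BA')

theorem lead_BB'_A : lead Q.A (quad s(Q.B, Q.B')) ≠ 0 := by
  rw [lead_quad]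
  exact mul_ne_zero (wedge_ne_zero Q.not_parallel_AB)
    (wedge_ne_zero fun h => Q.not_parallel_B'A h.symm)

theorem lead_BB'_A' : lead Q.A' (quad s(Q.B, Q.B')) ≠ 0 := by
  rw [lead_quad]
  exact mul_ne_zero (wedge_ne_zero fun h => Q.not_parallel_BA' h.symm)
    (wedge_ne_zero Q.not_parallel_A'B')

/-- No direction belongs to both pairs of opposite sides. -/
theorem lead_ne_zero (l : Line 𝕜) :
    lead l (quad s(Q.A, Q.A')) ≠ 0 ∨ lead l (quad s(Q.B, Q.B')) ≠ 0 := by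
  by_contra! h
  obtain ⟨h1, h2⟩ := h
  rw [lead_quad, mul_eq_zero, ← parallel_iff_wedge, ← parallel_iff_wedge] at h1 h2
  rcases h1 with h1 | h1 <;> rcases h2 with h2 | h2
  · exact Q.not_parallel_AB (h1.symm.trans h2)
  · exact Q.not_parallel_B'A (h2.symm.trans h1)
  · exact Q.not_parallel_BA' (h2.symm.trans h1)
  · exact Q.not_parallel_A'B' (h1.symm.trans h2)

theorem bisector_iff (h2 : (2 : 𝕜) ≠ 0) (l : Line 𝕜) :
    Q.Bisector l ↔ lead l (quad s(Q.A, Q.A')) * lin l (quad s(Q.B, Q.B')) =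
      lead l (quad s(Q.B, Q.B')) * lin l (quad s(Q.A, Q.A')) := by
  rw [Bisector, bisects_iff h2]
  simp only [oppositeSides, Set.mem_insert_iff, Set.mem_singleton_iff, forall_eq_or_imp, forall_eq,
    true_and, and_true]
  exact ⟨fun h => h.1, fun h => ⟨h, h.symm⟩⟩

theorem Bisector.bisects_sideNet {Q : Quadrilateral 𝕜} (h2 : (2 : 𝕜) ≠ 0) {l : Line 𝕜}
    (h : Q.Bisector l) : l.Bisects Q.sideNet :=
  bisects_net h2 ((Q.bisector_iff h2 l).1 h)

theorem bisector_of_mem (h2 : (2 : 𝕜) ≠ 0) {R : Sym2 (Line 𝕜)} (hR : R ∈ Q.sideNet) {l : Line 𝕜}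
    (hl : l ∈ R) : Q.Bisector l := by
  have h := (bisects_iff h2 _ _).1 (isBisectorArrangement_net h2 _ _ R hR l hl)
  exact (Q.bisector_iff h2 l).2 (h _ (left_mem_net _ _) _ (right_mem_net _ _))

/-- Every bisector of a quadrilateral is a component of a degenerate conic of its net. -/
theorem Bisector.exists_mem_sideNet {Q : Quadrilateral 𝕜} (h2 : (2 : 𝕜) ≠ 0) {l : Line 𝕜}
    (h : Q.Bisector l) : ∃ m, s(l, m) ∈ Q.sideNet := by
  rw [Q.bisector_iff h2] at h
  set f := quad s(Q.A, Q.A') with hf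
  set g := quad s(Q.B, Q.B') with hg
  have hq : ¬ ((lead l g • f - lead l f • g) 0 = 0 ∧ (lead l g • f - lead l f • g) 1 = 0 ∧
      (lead l g • f - lead l f • g) 2 = 0) := by
    rintro ⟨h0, h1, h2⟩
    have hz : ∀ n : Line 𝕜, lead n (lead l g • f - lead l f • g) = 0 := by
      intro n
      rw [lead_apply, h0, h1, h2]
      ring
    have hA := hz Q.A
    have hB := hz Q.B
    simp only [map_sub, map_smul, smul_eq_mul] at hA hB
    rw [hf, lead_quad_of_mem (Sym2.mem_mk_left _ _), ← hf, mul_zero, zero_sub, neg_eq_zero] at hA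
    rw [hg, lead_quad_of_mem (Sym2.mem_mk_left _ _), ← hg, mul_zero, sub_zero] at hB
    have e1 := (mul_eq_zero.1 hA).resolve_right Q.lead_BB'_A
    have e2 := (mul_eq_zero.1 hB).resolve_right Q.lead_AA'_B
    exact (Q.lead_ne_zero l).elim (fun h => h e1) (fun h => h e2)
  obtain ⟨m, c, hc, hm⟩ := exists_partner (l := l) (f := lead l g • f - lead l f • g)
    (by simp only [map_sub, map_smul, smul_eq_mul]; ring)
    (by simp only [map_sub, map_smul, smul_eq_mul]; linear_combination -h) hq
  refine ⟨m, c⁻¹ * lead l g, -(c⁻¹ * lead l f), ?_⟩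
  rw [neg_smul, ← sub_eq_add_neg, mul_smul, mul_smul, ← smul_sub, hm, inv_smul_smul₀ hc]

theorem hasMidpoint_of_lead {P : Sym2 (Line 𝕜)} (h2 : (2 : 𝕜) ≠ 0) (hP : P ∈ Q.oppositeSides)
    {l : Line 𝕜} (h : lead l (quad P) ≠ 0) :
    Q.HasMidpoint l (l.param (-(lin l (quad P)) / (2 * lead l (quad P)))) :=
  ⟨P, hP, (crosses_iff _ _).2 (Or.inl h), midOn_eq_some h2 h⟩

theorem HasMidpoint.mem {Q : Quadrilateral 𝕜} (h2 : (2 : 𝕜) ≠ 0) {l : Line 𝕜} {p : 𝕜 × 𝕜}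
    (h : Q.HasMidpoint l p) : p ∈ l.points := by
  obtain ⟨P, -, -, hp⟩ := h
  rw [midOn_eq h2] at hp
  split_ifs at hp
  rw [← Option.some.inj hp]
  exact param_mem _ _

theorem HasMidpoint.unique {Q : Quadrilateral 𝕜} {l : Line 𝕜} {p q : 𝕜 × 𝕜} (hl : Q.Bisector l)
    (hp : Q.HasMidpoint l p) (hq : Q.HasMidpoint l q) : p = q := by
  obtain ⟨P, hP, hc, hp⟩ := hp
  obtain ⟨P', hP', hc', hq⟩ := hq
  exact Option.some.inj (hp.symm.trans ((hl P hP P' hP' hc hc').trans hq))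

theorem AA'_mem : s(Q.A, Q.A') ∈ Q.oppositeSides := Or.inl rfl

theorem BB'_mem : s(Q.B, Q.B') ∈ Q.oppositeSides := Or.inr rfl

/-- The midpoint of a bisector is its midpoint on all crossed pairs of the net. -/
theorem Bisector.exists_midpoint {Q : Quadrilateral 𝕜} (h2 : (2 : 𝕜) ≠ 0) {l : Line 𝕜}
    (h : Q.Bisector l) :
    ∃ p, Q.HasMidpoint l p ∧ ∀ R ∈ Q.sideNet, l.Crosses R → l.midOn R = some p := by
  have hb := (bisects_iff h2 _ _).1 (h.bisects_sideNet h2)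
  rcases Q.lead_ne_zero l with h0 | h0
  · refine ⟨_, Q.hasMidpoint_of_lead h2 Q.AA'_mem h0, fun R hR hc => ?_⟩
    rw [← midOn_eq_some h2 h0]
    exact midOn_eq_of_proportional h2 h0 hc (hb _ (left_mem_net _ _) _ hR)
  · refine ⟨_, Q.hasMidpoint_of_lead h2 Q.BB'_mem h0, fun R hR hc => ?_⟩
    rw [← midOn_eq_some h2 h0]
    exact midOn_eq_of_proportional h2 h0 hc (hb _ (right_mem_net _ _) _ hR)

theorem centroid_eq_netCentroid (h2 : (2 : 𝕜) ≠ 0) :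
    Q.centroid = netCentroid (quad s(Q.A, Q.A')) (quad s(Q.B, Q.B')) := by
  have key : ∀ l : Line 𝕜, ¬ l.Parallel Q.B → ¬ l.Parallel Q.B' →
      lead l (quad s(Q.B, Q.B')) ≠ 0 →
      l.param (-(lin l (quad s(Q.B, Q.B'))) / (2 * lead l (quad s(Q.B, Q.B')))) =
        mid (l.meet Q.B) (l.meet Q.B') := by
    intro l h h' h0
    have := midOn_eq_some h2 h0
    simp only [midOn, Sym2.lift_mk, h, h', or_self, if_false, Option.some.injEq] at this
    exact this.symm
  rw [netCentroid_quad h2 _ _ _ Q.lead_BB'_A Q.lead_BB'_A',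
    key _ Q.not_parallel_AB (fun h => Q.not_parallel_B'A h.symm) Q.lead_BB'_A,
    key _ (fun h => Q.not_parallel_BA' h.symm) Q.not_parallel_A'B' Q.lead_BB'_A',
    centroid, meet_comm Q.B Q.A', meet_comm Q.B' Q.A]
  simp only [mid, Prod.mk.injEq]
  constructor <;> ring

/-- The lines of a pair in the net are antipodal. Their midpoints are computed on a pair of
opposite sides which spans the net together with the given pair. -/
theorem antipodal_of_mem (h2 : (2 : 𝕜) ≠ 0) {l m : Line 𝕜} (h : s(l, m) ∈ Q.sideNet) :
    Q.Antipodal l m := by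
  obtain ⟨a, b, hab⟩ := h
  have hl := lead_quad_of_mem (Sym2.mem_mk_left l m)
  have hm := lead_quad_of_mem (Sym2.mem_mk_right l m)
  simp only [hab, map_add, map_smul, smul_eq_mul] at hl hm
  rw [Antipodal, Q.centroid_eq_netCentroid h2]
  by_cases ha : a = 0
  · have hb : b ≠ 0 := by
      rintro rfl
      exact quad_ne_zero s(l, m) (by simp [hab, ha])
    have key : ∀ n : Line 𝕜, a * lead n (quad s(Q.A, Q.A')) + b * lead n (quad s(Q.B, Q.B')) = 0 →
        lead n (quad s(Q.A, Q.A')) ≠ 0 := by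
      intro n hn h0
      refine (Q.lead_ne_zero n).elim (fun h => h h0) fun h => ?_
      rw [h0, mul_zero, zero_add] at hn
      exact mul_ne_zero hb h hn
    refine ⟨_, _, Q.hasMidpoint_of_lead h2 Q.AA'_mem (key l hl),
      Q.hasMidpoint_of_lead h2 Q.AA'_mem (key m hm), ?_⟩
    rw [← netCentroid_quad h2 _ _ _ (key l hl) (key m hm), hab, add_comm,
      netCentroid_smul_add hb, netCentroid_comm]
  · have key : ∀ n : Line 𝕜, a * lead n (quad s(Q.A, Q.A')) + b * lead n (quad s(Q.B, Q.B')) = 0 →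
        lead n (quad s(Q.B, Q.B')) ≠ 0 := by
      intro n hn h0
      refine (Q.lead_ne_zero n).elim (fun h => ?_) fun h => h h0
      rw [h0, mul_zero, add_zero] at hn
      exact mul_ne_zero ha h hn
    refine ⟨_, _, Q.hasMidpoint_of_lead h2 Q.BB'_mem (key l hl),
      Q.hasMidpoint_of_lead h2 Q.BB'_mem (key m hm), ?_⟩
    rw [← netCentroid_quad h2 _ _ _ (key l hl) (key m hm), hab, netCentroid_smul_add ha]

/-- The inner product of `Q` is the linear functional on quadratic forms which vanishes on the
quadratic parts of the products of opposite sides. -/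
theorem inner_eq (l m : Line 𝕜) : Q.inner (l.u, l.t) (m.u, m.t) =
    Q.α * quad s(l, m) 0 + Q.β * quad s(l, m) 1 + Q.γ * quad s(l, m) 2 := by
  simp [inner, quad_mk]
  ring

theorem orthogonal_of_mem {l m : Line 𝕜} (h : s(l, m) ∈ Q.sideNet) : Q.Orthogonal l m := by
  obtain ⟨a, b, hab⟩ := h
  rw [Orthogonal, inner_eq, hab]
  simp [quad_mk, α, β, γ]
  ring

/-- The inner product of `Q` is nondegenerate: its determinant is the resultant of the quadratic
parts of the products of opposite sides. -/
theorem det_inner_ne_zero : Q.α * Q.γ - Q.β ^ 2 ≠ 0 := by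
  have e : Q.α * Q.γ - Q.β ^ 2 = -(Q.A.wedge Q.B * Q.B.wedge Q.A' * Q.A'.wedge Q.B' *
      Q.B'.wedge Q.A) := by
    simp only [α, β, γ, wedge]; ring
  rw [e, neg_ne_zero]
  exact mul_ne_zero (mul_ne_zero (mul_ne_zero
    (wedge_ne_zero fun h => Q.not_parallel_AB h.symm)
    (wedge_ne_zero fun h => Q.not_parallel_BA' h.symm))
    (wedge_ne_zero fun h => Q.not_parallel_A'B' h.symm))
    (wedge_ne_zero fun h => Q.not_parallel_B'A h.symm)

theorem parallel_of_orthogonal {l m n : Line 𝕜} (hm : Q.Orthogonal l m) (hn : Q.Orthogonal l n) :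
    m.Parallel n := by
  rw [parallel_iff_wedge]
  simp only [Orthogonal, inner] at hm hn
  have hdet := Q.det_inner_ne_zero
  have h1 : (Q.γ * l.u - Q.β * l.t) * n.wedge m = 0 := by
    simp only [wedge]
    linear_combination n.t * hm - m.t * hn
  have h2 : (Q.α * l.t - Q.β * l.u) * n.wedge m = 0 := by
    simp only [wedge]
    linear_combination m.u * hn - n.u * hm
  have hu : l.u * ((Q.α * Q.γ - Q.β ^ 2) * n.wedge m) = 0 := by
    linear_combination Q.α * h1 + Q.β * h2
  have ht : l.t * ((Q.α * Q.γ - Q.β ^ 2) * n.wedge m) = 0 := by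
    linear_combination Q.β * h1 + Q.γ * h2
  have : (Q.α * Q.γ - Q.β ^ 2) * n.wedge m = 0 := by
    rcases l.normalized with h | ⟨-, h⟩
    · simpa only [h, one_mul] using hu
    · simpa only [h, one_mul] using ht
  exact (mul_eq_zero.1 this).resolve_left hdet

/-- The `Q`-pairs of bisectors are the degenerate conics of the net of `Q`. Any bisector `l` is a
component of such a conic; its other component is determined by its direction, which is orthogonal
to `l`, and by its midpoint, which is antipodal to that of `l`. -/
theorem qPairs_eq_sideNet (h2 : (2 : 𝕜) ≠ 0) : Q.qPairs = Q.sideNet := by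
  ext R
  constructor
  · rintro ⟨l, m, rfl, hl, -, ⟨p, q, hp, hq, hpq⟩, ho⟩
    obtain ⟨n, hn⟩ := hl.exists_mem_sideNet h2
    obtain ⟨p', q', hp', hq', hpq'⟩ := Q.antipodal_of_mem h2 hn
    obtain rfl := HasMidpoint.unique hl hp hp'
    have hqq : q = q' := by
      rw [← hpq'] at hpq
      simp only [mid, Prod.mk.injEq, div_left_inj' h2, add_right_inj] at hpq
      exact Prod.ext hpq.1 hpq.2
    subst hqq
    have hmn := Q.parallel_of_orthogonal ho (Q.orthogonal_of_mem hn)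
    rwa [eq_of_parallel_of_mem hmn (hq.mem h2) (hq'.mem h2)]
  · intro hR
    induction R using Sym2.ind with
    | _ l m =>
      exact ⟨l, m, rfl, Q.bisector_of_mem h2 hR (Sym2.mem_mk_left _ _),
        Q.bisector_of_mem h2 hR (Sym2.mem_mk_right _ _), Q.antipodal_of_mem h2 hR,
        Q.orthogonal_of_mem hR⟩

/-! ### The net of a quadrilateral is an affine bisector field -/

/-- A bisector arrangement which contains the two pairs of opposite sides of a quadrilateral is
contained in its net. If the product `f` of another pair were not in the span of the two products of
opposite sides, then, modulo this span, `f` would be a multiple of the product of the forms of `A`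
and `B`, and the bisection by `A'` and `B'` would force all sides through the point `A' ∩ B'`. -/
theorem subset_sideNet (h2 : (2 : 𝕜) ≠ 0) {𝔹 : Set (Sym2 (Line 𝕜))}
    (h𝔹 : IsBisectorArrangement 𝔹) (hA : s(Q.A, Q.A') ∈ 𝔹) (hB : s(Q.B, Q.B') ∈ 𝔹) :
    𝔹 ⊆ Q.sideNet := by
  intro R hR
  have bis : ∀ P ∈ 𝔹, ∀ l ∈ P, ∀ P' ∈ 𝔹, lead l (quad R) * lin l (quad P') =
      lead l (quad P') * lin l (quad R) := fun P hP l hl P' hP' =>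
    (bisects_iff h2 _ _).1 (h𝔹 P hP l hl) R hR P' hP'
  have bA := bis _ hA _ (Sym2.mem_mk_left _ _) _ hB
  have bA' := bis _ hA _ (Sym2.mem_mk_right _ _) _ hB
  have bB := bis _ hB _ (Sym2.mem_mk_left _ _) _ hA
  have bB' := bis _ hB _ (Sym2.mem_mk_right _ _) _ hA
  have zA := lead_quad_of_mem (Sym2.mem_mk_left Q.A Q.A')
  have zA' := lead_quad_of_mem (Sym2.mem_mk_right Q.A Q.A')
  have zB := lead_quad_of_mem (Sym2.mem_mk_left Q.B Q.B')
  have zB' := lead_quad_of_mem (Sym2.mem_mk_right Q.B Q.B')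
  have yA := lin_quad_of_mem (Sym2.mem_mk_left Q.A Q.A')
  have yA' := lin_quad_of_mem (Sym2.mem_mk_right Q.A Q.A')
  have yB := lin_quad_of_mem (Sym2.mem_mk_left Q.B Q.B')
  have yB' := lin_quad_of_mem (Sym2.mem_mk_right Q.B Q.B')
  have nA := Q.lead_BB'_A
  have nB := Q.lead_AA'_B
  set f := quad s(Q.A, Q.A') with hf
  set g := quad s(Q.B, Q.B') with hg
  -- The coefficients are chosen so that the quadratic part of the difference vanishes in the
  -- directions of `A` and of `B`.
  set a := lead Q.B (quad R) / lead Q.B f with ha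
  set b := lead Q.A (quad R) / lead Q.A g with hb
  have ea : a * lead Q.B f = lead Q.B (quad R) := div_mul_cancel₀ _ nB
  have eb : b * lead Q.A g = lead Q.A (quad R) := div_mul_cancel₀ _ nA
  obtain ⟨c, hc⟩ := eq_smul_quad_of_const Q.not_parallel_AB (f := quad R - (a • f + b • g))
    (by simp only [map_sub, map_add, map_smul, smul_eq_mul, zA]; linear_combination -eb)
    (by
      simp only [map_sub, map_add, map_smul, smul_eq_mul, yA]
      apply mul_left_cancel₀ nA
      linear_combination -bA - lin Q.A g * eb)
    (by simp only [map_sub, map_add, map_smul, smul_eq_mul, zB]; linear_combination -ea)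
    (by
      simp only [map_sub, map_add, map_smul, smul_eq_mul, yB]
      apply mul_left_cancel₀ nB
      linear_combination -bB - lin Q.B f * ea)
  by_cases hc0 : c = 0
  · rw [hc0, zero_smul, sub_eq_zero] at hc
    exact ⟨a, b, hc⟩
  exfalso
  rw [sub_eq_iff_eq_add] at hc
  have h1 : lead Q.A' (quad s(Q.A, Q.B)) * lin Q.A' g = lead Q.A' g * lin Q.A' (quad s(Q.A, Q.B)) := by
    rw [hc] at bA'
    simp only [map_add, map_smul, smul_eq_mul, zA', yA'] at bA'
    apply mul_left_cancel₀ hc0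
    linear_combination bA'
  have h2 : lead Q.B' (quad s(Q.A, Q.B)) * lin Q.B' f = lead Q.B' f * lin Q.B' (quad s(Q.A, Q.B)) := by
    rw [hc] at bB'
    simp only [map_add, map_smul, smul_eq_mul, zB', yB'] at bB'
    apply mul_left_cancel₀ hc0
    linear_combination bB'
  have hA'B : ¬ Q.A'.Parallel Q.B := fun h => Q.not_parallel_BA' h.symm
  have hB'A' : ¬ Q.B'.Parallel Q.A' := fun h => Q.not_parallel_A'B' h.symm
  have m1 := meet_mem_of_proportional hA'B Q.not_parallel_A'B' h1
  rw [Sym2.eq_swap] at h2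
  have m2 := meet_mem_of_proportional Q.not_parallel_B'A hB'A' h2
  rw [meet_comm] at m2
  exact Q.not_concurrent ⟨_, m1, m2, meet_mem_left Q.not_parallel_A'B',
    meet_mem_right Q.not_parallel_A'B'⟩

theorem not_isTrivial_sideNet : ¬ IsTrivial Q.sideNet := by
  have hA : s(Q.A, Q.A') ∈ Q.sideNet := left_mem_net _ _
  have hB : s(Q.B, Q.B') ∈ Q.sideNet := right_mem_net _ _
  rintro (⟨p, hp⟩ | h | h)
  · exact Q.not_concurrent ⟨p, hp _ hA _ (by simp), hp _ hB _ (by simp), hp _ hA _ (by simp),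
      hp _ hB _ (by simp)⟩
  · exact Q.not_parallel_AB (h _ hA _ (by simp) _ hB _ (by simp))
  · obtain ⟨w, hw⟩ := h _ hA _ hB
    rw [Sym2.map_mk] at hw
    have : Q.B ∈ s(translate w Q.A, translate w Q.A') := hw ▸ Sym2.mem_mk_left _ _
    rcases Sym2.mem_iff.1 this with e | e
    · exact Q.not_parallel_AB (e ▸ ⟨rfl, rfl⟩)
    · exact Q.not_parallel_BA' (e ▸ ⟨rfl, rfl⟩)

/-- The net contains, up to constants, only one conic with a given asymptotic direction. -/
theorem isAffine_sideNet : IsAffine Q.sideNet := by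
  rintro R ⟨a, b, hR⟩ R' ⟨a', b', hR'⟩ hne l hl l' hl' hp
  have e := lead_quad_of_mem hl
  have e' : lead l (quad R') = 0 := by
    have := lead_quad_of_mem hl'
    rw [lead_apply, ← hp.1, ← hp.2] at this
    exact this
  rw [hR] at e
  rw [hR'] at e'
  simp only [map_add, map_smul, smul_eq_mul] at e e'
  have hdet : a * b' = a' * b := by
    rcases Q.lead_ne_zero l with h | h
    · apply mul_right_cancel₀ h
      linear_combination b' * e - b * e'
    · apply mul_right_cancel₀ h
      linear_combination a * e' - a' * e
  have h1 : a • quad R' = a' • quad R := by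
    rw [hR, hR', smul_add, smul_add, smul_smul, smul_smul, smul_smul, smul_smul, hdet,
      mul_comm a a']
  have h2 : b • quad R' = b' • quad R := by
    rw [hR, hR', smul_add, smul_add, smul_smul, smul_smul, smul_smul, smul_smul, mul_comm b a',
      ← hdet, mul_comm b b', mul_comm a b']
  obtain ⟨x, y, hx, hxy⟩ : ∃ x y : 𝕜, x ≠ 0 ∧ x • quad R' = y • quad R := by
    by_cases ha : a = 0
    · refine ⟨b, b', ?_, h2⟩
      rintro rfl
      exact quad_ne_zero R (by simp [hR, ha])
    · exact ⟨a, a', ha, h1⟩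
  have hy : y ≠ 0 := by
    rintro rfl
    rw [zero_smul, smul_eq_zero] at hxy
    exact hxy.elim hx (quad_ne_zero R')
  refine parallel_of_quad_eq_smul hne (mul_ne_zero (inv_ne_zero hx) hy) ?_ hl hl' hp
  rw [mul_smul, ← hxy, inv_smul_smul₀ hx]

theorem isAffineBisectorField_sideNet (h2 : (2 : 𝕜) ≠ 0) : IsAffineBisectorField Q.sideNet :=
  ⟨⟨isBisectorArrangement_net h2 _ _, Q.not_isTrivial_sideNet, fun _ h𝔹 hsub =>
    (Q.subset_sideNet h2 h𝔹 (hsub (left_mem_net _ _)) (hsub (right_mem_net _ _))).antisymm hsub⟩,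
    Q.isAffine_sideNet⟩

end Quadrilateral

/-! ### Every affine bisector field contains a quadrilateral -/

/-- The pairs `{A, A'}` and `{B, B'}` belong to `𝔹` for some quadrilateral `A B A' B'`. -/
def ContainsQuadrilateral (𝔹 : Set (Sym2 (Line 𝕜))) : Prop :=
  ∃ Q : Quadrilateral 𝕜, s(Q.A, Q.A') ∈ 𝔹 ∧ s(Q.B, Q.B') ∈ 𝔹

/-- The line with the same direction and the constant term raised by `c`. -/
def Line.shift (l : Line 𝕜) (c : 𝕜) : Line 𝕜 := ⟨l.t, l.u, l.v + c, l.normalized⟩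

theorem Line.parallel_shift (l : Line 𝕜) (c : 𝕜) : l.Parallel (l.shift c) := ⟨rfl, rfl⟩

/-- The pair of shifts of `n` by `1` and `-1` has the same product as the double line `{n, n}`,
up to a constant. -/
theorem quad_shift (n : Line 𝕜) : quad s(n.shift 1, n.shift (-1)) = quad s(n, n) := by
  refine vec5_ext ?_ ?_ ?_ ?_ ?_ <;> simp [quad_mk, Line.shift] <;> ring

/-- If a bisector field lies in the net of a pair of distinct lines and a double line `n`, then by
maximality it contains the pair of shifts of `n` by `1` and `-1`, hence a quadrilateral. -/
theorem containsQuadrilateral_of_double (h2 : (2 : 𝕜) ≠ 0) {𝔹 : Set (Sym2 (Line 𝕜))}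
    (h𝔹 : IsBisectorField 𝔹) {l m n : Line 𝕜} (hlm : l ≠ m) (hnl : ¬ n.Parallel l)
    (hnm : ¬ n.Parallel m) (hsub : 𝔹 ⊆ net s(l, m) s(n, n)) : ContainsQuadrilateral 𝔹 := by
  have heq := h𝔹.2.2 _ (isBisectorArrangement_net h2 _ _) hsub
  have hne : n.shift 1 ≠ n.shift (-1) := by
    intro h
    have := congrArg Line.v h
    simp only [Line.shift, add_right_inj] at this
    exact h2 (by linear_combination this)
  have hp := n.parallel_shift (1 : 𝕜)
  have hp' := n.parallel_shift (-1 : 𝕜)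
  refine ⟨⟨l, n.shift 1, m, n.shift (-1), hlm, hne, fun h => hnl (hp.trans h.symm),
    fun h => hnm (hp.trans h), fun h => hnm (hp'.trans h.symm), fun h => hnl (hp'.trans h), ?_⟩,
    ?_, ?_⟩
  · rintro ⟨p, -, h1, -, h3⟩
    exact hne (eq_of_parallel_of_mem (hp.symm.trans hp') h1 h3)
  · rw [← heq]
    exact left_mem_net _ _
  · rw [← heq]
    exact ⟨0, 1, by simp [quad_shift]⟩

theorem midOn_of_not_parallel {l m n : Line 𝕜} (hm : ¬ l.Parallel m) (hn : ¬ l.Parallel n) :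
    l.midOn s(m, n) = some (mid (l.meet m) (l.meet n)) := by
  simp [midOn, hm, hn]

theorem crosses_of_not_parallel {l m n : Line 𝕜} (hm : ¬ l.Parallel m) (hn : ¬ l.Parallel n) :
    l.Crosses s(m, n) := by
  refine ⟨fun h => ?_, fun h => hm (h m (by simp))⟩
  rcases Sym2.mem_iff.1 h with rfl | rfl
  · exact hm (Parallel.refl _)
  · exact hn (Parallel.refl _)

theorem mid_self (h2 : (2 : 𝕜) ≠ 0) (p : 𝕜 × 𝕜) : mid p p = p := by
  ext <;> simp only [mid] <;> field_simp <;> ring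

/-- A line of an arrangement which is not parallel to any line of two pairs has the same midpoint
on both of them. -/
theorem IsBisectorArrangement.mid_eq {𝔹 : Set (Sym2 (Line 𝕜))} (h𝔹 : IsBisectorArrangement 𝔹)
    {P : Sym2 (Line 𝕜)} (hP : P ∈ 𝔹) {l m n r s : Line 𝕜} (hl : l ∈ P) (hR : s(m, n) ∈ 𝔹)
    (hS : s(r, s) ∈ 𝔹) (hm : ¬ l.Parallel m) (hn : ¬ l.Parallel n) (hr : ¬ l.Parallel r)
    (hs : ¬ l.Parallel s) : mid (l.meet m) (l.meet n) = mid (l.meet r) (l.meet s) := by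
  have := h𝔹 P hP l hl _ hR _ hS (crosses_of_not_parallel hm hn) (crosses_of_not_parallel hr hs)
  rwa [midOn_of_not_parallel hm hn, midOn_of_not_parallel hr hs, Option.some.injEq] at this

/-- If a line of an arrangement meets two double lines `m` and `r`, it does so in one point. -/
theorem IsBisectorArrangement.meet_mem_of_double (h2 : (2 : 𝕜) ≠ 0) {𝔹 : Set (Sym2 (Line 𝕜))}
    (h𝔹 : IsBisectorArrangement 𝔹) {P : Sym2 (Line 𝕜)} (hP : P ∈ 𝔹) {l m r : Line 𝕜} (hl : l ∈ P)
    (hR : s(m, m) ∈ 𝔹) (hS : s(r, r) ∈ 𝔹) (hm : ¬ l.Parallel m) (hr : ¬ l.Parallel r) :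
    l.meet m ∈ r.points := by
  have := h𝔹.mid_eq hP hl hR hS hm hm hr hr
  rw [mid_self h2, mid_self h2] at this
  exact this ▸ meet_mem_right hr

/-- The case in which some pair of the field consists of two intersecting lines `l` and `m`. If
there is no quadrilateral, then the only other pair of the field is a double line. -/
theorem IsAffineBisectorField.containsQuadrilateral_of_not_parallel (h2 : (2 : 𝕜) ≠ 0)
    {𝔹 : Set (Sym2 (Line 𝕜))} (h𝔹 : IsAffineBisectorField 𝔹) {l m : Line 𝕜} (hP : s(l, m) ∈ 𝔹)
    (hlm : ¬ l.Parallel m) : ContainsQuadrilateral 𝔹 := by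
  by_contra hQ
  obtain ⟨hfield, haff⟩ := h𝔹
  have harr := hfield.1
  have hne : l ≠ m := fun h => hlm (h ▸ Parallel.refl l)
  -- No line of another pair is parallel to `l` or to `m`.
  have hcross : ∀ r s, s(r, s) ∈ 𝔹 → s(r, s) ≠ s(l, m) → ¬ r.Parallel l ∧ ¬ r.Parallel m := by
    intro r s hR hRne
    have := haff _ hR _ hP hRne r (by simp)
    exact ⟨fun h => hlm (h.symm.trans (this l (by simp) h m (by simp))),
      fun h => hlm ((this m (by simp) h l (by simp)).symm.trans h)⟩
  have hcross' : ∀ r s, s(r, s) ∈ 𝔹 → s(r, s) ≠ s(l, m) → ¬ s.Parallel l ∧ ¬ s.Parallel m := by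
    intro r s hR hRne
    rw [Sym2.eq_swap] at hR hRne
    exact hcross s r hR hRne
  -- The other pairs are double lines or pairs of lines through the intersection of `l` and `m`.
  have hconc : ∀ r s, s(r, s) ∈ 𝔹 → s(r, s) ≠ s(l, m) → r ≠ s →
      l.meet m ∈ r.points ∧ l.meet m ∈ s.points := by
    intro r s hR hRne hrs
    obtain ⟨h1, h1'⟩ := hcross r s hR hRne
    obtain ⟨h3, h3'⟩ := hcross' r s hR hRne
    by_contra hcon
    refine hQ ⟨⟨l, r, m, s, hne, hrs, fun h => h1 h.symm, h1', fun h => h3' h.symm, h3, ?_⟩, hP, hR⟩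
    rintro ⟨p, pl, pr, pm, ps⟩
    obtain rfl := (mem_points_inter_iff hlm p).1 ⟨pl, pm⟩
    exact hcon ⟨pr, ps⟩
  obtain ⟨n, hn, hO, hnne⟩ : ∃ n, s(n, n) ∈ 𝔹 ∧ l.meet m ∉ n.points ∧ s(n, n) ≠ s(l, m) := by
    by_contra! hcon
    refine hfield.2.1 (Or.inl ⟨l.meet m, fun R hR n hn => ?_⟩)
    obtain ⟨s, rfl⟩ := hn
    by_cases hRne : s(n, s) = s(l, m)
    · have : n ∈ s(l, m) := hRne ▸ Sym2.mem_mk_left _ _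
      rcases Sym2.mem_iff.1 this with rfl | rfl
      · exact meet_mem_left hlm
      · exact meet_mem_right hlm
    by_cases hns : n = s
    · subst hns
      by_contra hO
      exact hRne (hcon n hR hO)
    · exact (hconc n s hR hRne hns).1
  obtain ⟨hnl, hnm⟩ := hcross n n hn hnne
  refine hQ (containsQuadrilateral_of_double h2 hfield hne hnl hnm fun R hR => ?_)
  induction R using Sym2.ind with
  | _ r s =>
    by_cases hRne : s(r, s) = s(l, m)
    · rw [hRne]
      exact left_mem_net _ _
    obtain ⟨hrl, hrm⟩ := hcross r s hR hRne
    obtain ⟨hsl, hsm⟩ := hcross' r s hR hRne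
    by_cases hrs : r = s
    · subst hrs
      have h1 := harr.meet_mem_of_double h2 hP (Sym2.mem_mk_left l m) hn hR
        (fun h => hnl h.symm) (fun h => hrl h.symm)
      have h3 := harr.meet_mem_of_double h2 hP (Sym2.mem_mk_right l m) hn hR
        (fun h => hnm h.symm) (fun h => hrm h.symm)
      have hpq : l.meet n ≠ m.meet n := by
        intro h
        refine hO ?_
        rw [← (mem_points_inter_iff hlm (l.meet n)).1 ⟨meet_mem_left fun h => hnl h.symm,
          h ▸ meet_mem_left fun h => hnm h.symm⟩]
        exact meet_mem_right fun h => hnl h.symm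
      rw [eq_of_two_points hpq h1 h3 (meet_mem_right fun h => hnl h.symm)
        (meet_mem_right fun h => hnm h.symm)]
      exact right_mem_net _ _
    · exfalso
      obtain ⟨hr, hs⟩ := hconc r s hR hRne hrs
      have := harr.mid_eq hP (Sym2.mem_mk_left l m) hn hR (fun h => hnl h.symm)
        (fun h => hnl h.symm) (fun h => hrl h.symm) (fun h => hsl h.symm)
      rw [← (mem_points_inter_iff (fun h => hrl h.symm) _).1 ⟨meet_mem_left hlm, hr⟩,
        ← (mem_points_inter_iff (fun h => hsl h.symm) _).1 ⟨meet_mem_left hlm, hs⟩, mid_self h2,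
        mid_self h2] at this
      exact hO (this ▸ meet_mem_right fun h => hnl h.symm)

/-- Pairs of lines of one direction are equal modulo constants if a transversal has the same
midpoint on them. -/
theorem quad_eq_of_mid_eq (h2 : (2 : 𝕜) ≠ 0) {n l m r s : Line 𝕜} (hm : l.Parallel m)
    (hr : l.Parallel r) (hs : l.Parallel s) (hn : ¬ n.Parallel l)
    (h : mid (n.meet l) (n.meet m) = mid (n.meet r) (n.meet s)) : quad s(r, s) = quad s(l, m) := by
  have key : ∀ k : Line 𝕜, l.Parallel k →
      k.v = -(l.t * (n.meet k).1 - l.u * (n.meet k).2) := by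
    intro k hk
    have := meet_mem_right (l := n) (m := k) fun h' => hn (h'.trans hk.symm)
    simp only [points, Set.mem_ofPred_eq, ← hk.1, ← hk.2] at this
    linear_combination this
  simp only [mid, Prod.mk.injEq, div_left_inj' h2] at h
  have hv : r.v + s.v = l.v + m.v := by
    rw [key l (Parallel.refl l), key m hm, key r hr, key s hs]
    linear_combination l.t * h.1 - l.u * h.2
  refine vec5_ext ?_ ?_ ?_ ?_ ?_ <;> simp [quad_mk, ← hm.1, ← hm.2, ← hr.1, ← hr.2, ← hs.1, ← hs.2]
  · linear_combination l.t * hv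
  · linear_combination -l.u * hv

/-- The case in which every pair of the field consists of parallel or equal lines. If all pairs are
double lines, then all lines are concurrent. If there is no quadrilateral, then all pairs of
distinct lines have one direction, and there is only one double line in other directions. -/
theorem IsBisectorField.containsQuadrilateral_of_parallel (h2 : (2 : 𝕜) ≠ 0)
    {𝔹 : Set (Sym2 (Line 𝕜))} (h𝔹 : IsBisectorField 𝔹)
    (hpar : ∀ l m, s(l, m) ∈ 𝔹 → l.Parallel m) : ContainsQuadrilateral 𝔹 := by
  by_contra hQ
  have harr := h𝔹.1
  -- Two pairs of different directions cannot both consist of distinct lines.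
  have hdouble : ∀ l m n r, s(l, m) ∈ 𝔹 → s(n, r) ∈ 𝔹 → l ≠ m → ¬ n.Parallel l → n = r := by
    intro l m n r hP hR hlm hnl
    by_contra hnr
    have h1 := hpar _ _ hP
    have h3 := hpar _ _ hR
    refine hQ ⟨⟨l, n, m, r, hlm, hnr, fun h => hnl h.symm, fun h => hnl (h.trans h1.symm),
      fun h => hnl (h3.trans (h1.trans h).symm), fun h => hnl (h3.trans h), ?_⟩, hP, hR⟩
    rintro ⟨p, pl, -, pm, -⟩
    exact hlm (eq_of_parallel_of_mem h1 pl pm)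
  obtain ⟨l, m, hP, hlm⟩ : ∃ l m, s(l, m) ∈ 𝔹 ∧ l ≠ m := by
    by_contra! hall
    refine h𝔹.2.1 (Or.inr (Or.inl ?_))
    by_contra! hcon
    obtain ⟨_, hP, l, ⟨l', rfl⟩, _, hP', n, ⟨n', rfl⟩, hln⟩ := hcon
    obtain rfl := hall _ _ hP
    obtain rfl := hall _ _ hP'
    refine h𝔹.2.1 (Or.inl ⟨l.meet n, fun R hR r hr => ?_⟩)
    obtain ⟨r', rfl⟩ := hr
    obtain rfl := hall _ _ hR
    by_cases hnr : n.Parallel r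
    · exact harr.meet_mem_of_double h2 hP (Sym2.mem_mk_left _ _) hP' hR hln
        fun h => hln (h.trans hnr.symm)
    · rw [meet_comm]
      exact harr.meet_mem_of_double h2 hP' (Sym2.mem_mk_left _ _) hP hR (fun h => hln h.symm) hnr
  have hl := hpar _ _ hP
  obtain ⟨n, hn, hnl⟩ : ∃ n, s(n, n) ∈ 𝔹 ∧ ¬ n.Parallel l := by
    by_contra! hcon
    have hall : ∀ R ∈ 𝔹, ∀ r ∈ R, r.Parallel l := by
      rintro _ hR r ⟨s, rfl⟩
      by_contra hr
      obtain rfl := hdouble l m r s hP hR hlm hr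
      exact hr (hcon r hR)
    exact h𝔹.2.1 (Or.inr (Or.inl fun R hR r hr R' hR' r' hr' =>
      (hall R hR r hr).trans (hall R' hR' r' hr').symm))
  have hnm : ¬ n.Parallel m := fun h => hnl (h.trans hl.symm)
  refine hQ (containsQuadrilateral_of_double h2 h𝔹 hlm hnl hnm fun R hR => ?_)
  induction R using Sym2.ind with
  | _ r s =>
    have hrs := hpar _ _ hR
    by_cases hr : r.Parallel l
    · refine ⟨1, 0, ?_⟩
      rw [one_smul, zero_smul, add_zero]
      have hs := hrs.symm.trans hr
      exact quad_eq_of_mid_eq h2 hl hr.symm hs.symm hnl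
        (harr.mid_eq hn (Sym2.mem_mk_left _ _) hP hR hnl hnm (fun h => hnl (h.trans hr))
          fun h => hnl (h.trans hs))
    · obtain rfl := hdouble l m r s hP hR hlm hr
      have hrm : ¬ m.Parallel r := fun h => hr (hl.trans h).symm
      have h1 := harr.meet_mem_of_double h2 hP (Sym2.mem_mk_left l m) hn hR
        (fun h => hnl h.symm) (fun h => hr h.symm)
      have h3 := harr.meet_mem_of_double h2 hP (Sym2.mem_mk_right l m) hn hR
        (fun h => hnm h.symm) hrm
      have hpq : l.meet n ≠ m.meet n := fun h =>
        hlm (eq_of_parallel_of_mem hl (meet_mem_left fun h => hnl h.symm)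
          (h ▸ meet_mem_left fun h => hnm h.symm))
      rw [eq_of_two_points hpq h1 h3 (meet_mem_right fun h => hnl h.symm)
        (meet_mem_right fun h => hnm h.symm)]
      exact right_mem_net _ _

theorem IsAffineBisectorField.containsQuadrilateral (h2 : (2 : 𝕜) ≠ 0)
    {𝔹 : Set (Sym2 (Line 𝕜))} (h𝔹 : IsAffineBisectorField 𝔹) : ContainsQuadrilateral 𝔹 := by
  by_cases hpar : ∀ l m, s(l, m) ∈ 𝔹 → l.Parallel m
  · exact h𝔹.1.containsQuadrilateral_of_parallel h2 hpar
  · push Not at hpar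
    obtain ⟨l, m, hP, hlm⟩ := hpar
    exact h𝔹.containsQuadrilateral_of_not_parallel h2 hP hlm

end BisectorField

theorem theorem6p9 {𝕜 : Type*} [Field 𝕜] (hchar : ringChar 𝕜 ≠ 2) :
    (∀ 𝔹 : Set (Sym2 (BisectorField.Line 𝕜)),
      BisectorField.IsAffineBisectorField 𝔹 ↔
        ∃ Q : BisectorField.Quadrilateral 𝕜, 𝔹 = Q.qPairs) ∧
    (∀ (Q : BisectorField.Quadrilateral 𝕜) (l : BisectorField.Line 𝕜), Q.Bisector l →
      l.Bisects Q.qPairs ∧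
        ∃ p, Q.HasMidpoint l p ∧ ∀ P ∈ Q.qPairs, l.Crosses P → l.midOn P = some p) := by
  have h2 : (2 : 𝕜) ≠ 0 := Ring.two_ne_zero hchar
  refine ⟨fun 𝔹 => ⟨fun h𝔹 => ?_, ?_⟩, fun Q l hl => ?_⟩
  · obtain ⟨Q, hA, hB⟩ := h𝔹.containsQuadrilateral h2
    refine ⟨Q, ?_⟩
    rw [Q.qPairs_eq_sideNet h2]
    exact (h𝔹.1.2.2 _ (BisectorField.isBisectorArrangement_net h2 _ _)
      (Q.subset_sideNet h2 h𝔹.1.1 hA hB)).symm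
  · rintro ⟨Q, rfl⟩
    rw [Q.qPairs_eq_sideNet h2]
    exact Q.isAffineBisectorField_sideNet h2
  · rw [Q.qPairs_eq_sideNet h2]
    exact ⟨hl.bisects_sideNet h2, hl.exists_midpoint h2⟩
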